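/- Write $\det(q_1,q_2,q_3)$ for the determinant of the $3\times 3$ matrix with rows $(q_i,1)$, i.e. twice the signed area of the triangle spanned by $q_1,q_2,q_3\in\mathbb R^2$. Let $\mathcal A=\{p_1,\dots,p_n\}\subset\mathbb R^2$ be a set of $n$ points in general position (distinct, no three collinear). Let $S$ be the space of all $(v,t)=(v_1,\dots,v_n,t_1,\dots,t_n)\in(\mathbb R^2)^n\times\mathbb R^n$ with $v_1^1=v_1^2=v_2^1=0$. For real constants $f=(f_{ij})$, one for each unordered pair of different indices $i,j\in\{0,1,\dots,n\}$, let $\overline{Y_f}(\mathcal A)$ be the polyhedron of all $(v,t)\in S$ such that $$\langle p_i-p_j,\,v_i-v_j\rangle-|p_i-p_j|\,(t_i+t_j)\ \ge\ f_{ij}\quad(1\le i<j\le n),\qquad t_j\ \ge\ f_{0j}\quad(1\le j\le n).$$ A marked graph on $\mathcal A$ is a straight-line graph with vertex set $\mathcal A$ together with a set of marked vertices. It is non-crossing if any two different edges meet at most in common end-points, and every marked vertex is pointed, i.e. its incident edges span an angle smaller than $180^\circ$. The tight marked graph of a non-empty face $F$ of $\overline{Y_f}(\mathcal A)$ has as edges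 the $p_ip_j$ and as marks the $p_j$ whose inequality above holds with equality at the relative interior points of $F$. The choice $f$ is called valid if the tight marked graph of every non-empty face of $\overline{Y_f}(\mathcal A)$ is non-crossing. Then: (1) For any $a,b\in\mathbb R^2$, the choice $f_{ij}:=\det(a,p_i,p_j)\det(b,p_i,p_j)$ for $1\le i<j\le n$, $f_{0j}:=0$, is valid. (2) In particular, the choice $f_{ij}:=\det(O,p_i,p_j)^2$, $f_{0j}:=0$, is valid, where $O$ is the origin. (3) For any four points $q_1,q_2,q_3,q_4\in\mathbb R^2$ in general position and any $a,b\in\mathbb R^2$, $$\sum_{1\le i<j\le 4} w_{ij}\,\det(a,q_i,q_j)\,\det(b,q_i,q_j)=1,\qquad w_{ij}=\frac{1}{\det(q_i,q_j,q_k)\,\det(q_i,q_j,q_l)},$$ where $k,l$ are the two indices in $\{1,2,3,4\}$ other than $i,j$. -/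

import Mathlib

namespace MarkedNonCrossing

/-- The Euclidean plane. -/
abbrev Plane : Type := EuclideanSpace ℝ (Fin 2)

/-- The determinant of three points of the plane in homogeneous coordinates, that is,
twice the signed area of the triangle that they span. -/
noncomputable def det3 (a b c : Plane) : ℝ :=
  Matrix.det !![a 0, a 1, 1; b 0, b 1, 1; c 0, c 1, 1]

/-- The points `p 0, …, p (n - 1)` are distinct and no three of them are collinear. -/
def GeneralPosition {n : ℕ} (p : Fin n → Plane) : Prop :=
  Function.Injective p ∧
    ∀ i j k : Fin n, i ≠ j → i ≠ k → j ≠ k → ¬ Collinear ℝ ({p i, p j, p k} : Set Plane)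

/-! ### Marked graphs -/

/-- A marked graph on `n` labelled points: a graph with a set of marked vertices. -/
structure MarkedGraph (n : ℕ) where
  graph : SimpleGraph (Fin n)
  marks : Set (Fin n)

/-- The straight-line drawing of `G` on `p` is non-crossing: two different edges meet at most
in common end-points. -/
def IsNonCrossingGraph {n : ℕ} (p : Fin n → Plane) (G : SimpleGraph (Fin n)) : Prop :=
  ∀ i j k l : Fin n, G.Adj i j → G.Adj k l → s(i, j) ≠ s(k, l) →
    segment ℝ (p i) (p j) ∩ segment ℝ (p k) (p l) ⊆ ({p i, p j} ∩ {p k, p l} : Set Plane)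

/-- The vertex `i` is pointed: its incident edges span an angle smaller than 180 degrees, that
is, they all leave `p i` into one open half-plane that is bounded by a line through `p i`. -/
def IsPointedVertex {n : ℕ} (p : Fin n → Plane) (G : SimpleGraph (Fin n)) (i : Fin n) : Prop :=
  ∃ u : Plane, ∀ j : Fin n, G.Adj i j → 0 < inner ℝ u (p j - p i)

/-- A marked graph is non-crossing if it is non-crossing as a graph and marks arise only in
pointed vertices. -/
def MarkedGraph.IsNonCrossing {n : ℕ} (p : Fin n → Plane) (G : MarkedGraph n) : Prop :=
  IsNonCrossingGraph p G.graph ∧ ∀ i ∈ G.marks, IsPointedVertex p G.graph i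

/-! ### The polyhedron of constrained expansions -/

/-- The space of all pairs `(v, t)` with `v ∈ (ℝ²)ⁿ` and `t ∈ ℝⁿ`. -/
abbrev Motions (n : ℕ) : Type := (Fin n → Plane) × (Fin n → ℝ)

/-- The subspace `S` where both coordinates of the velocity of the first point and the first
coordinate of the velocity of the second point vanish. -/
def normalizedMotions (n : ℕ) : Set (Motions n) :=
  {x | (∀ i : Fin n, (i : ℕ) = 0 → x.1 i 0 = 0 ∧ x.1 i 1 = 0) ∧
    ∀ i : Fin n, (i : ℕ) = 1 → x.1 i 0 = 0}

/-- A choice of constants: one number `edge i j = edge j i` for each pair of different points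
(the diagonal values are never used) and one number `mark j`, written `f_{0j}`, for each point. -/
structure Constants (n : ℕ) where
  edge : Fin n → Fin n → ℝ
  edge_symm : ∀ i j, edge i j = edge j i
  mark : Fin n → ℝ

/-- The linear form `⟨p_i - p_j, v_i - v_j⟩ - |p_i - p_j| (t_i + t_j)` at `x = (v, t)`. -/
noncomputable def edgeForm {n : ℕ} (p : Fin n → Plane) (i j : Fin n) (x : Motions n) : ℝ :=
  inner ℝ (p i - p j) (x.1 i - x.1 j) - ‖p i - p j‖ * (x.2 i + x.2 j)

theorem edgeForm_comm {n : ℕ} (p : Fin n → Plane) (i j : Fin n) (x : Motions n) :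
    edgeForm p i j x = edgeForm p j i x := by
  unfold edgeForm
  rw [← neg_sub (p j) (p i), ← neg_sub (x.1 j) (x.1 i), inner_neg_neg, norm_neg,
    add_comm (x.2 i)]

/-- The polyhedron of expansions of `p` constrained by `f`. -/
def expansionPolyhedron {n : ℕ} (p : Fin n → Plane) (f : Constants n) : Set (Motions n) :=
  {x | x ∈ normalizedMotions n ∧
    (∀ i j : Fin n, i ≠ j → f.edge i j ≤ edgeForm p i j x) ∧
    ∀ j : Fin n, f.mark j ≤ x.2 j}

/-- The tight marked graph of `x = (v, t)`: its edges and marks are the pairs of points and the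
points whose inequality is an equality at `x`. -/
def tightMarkedGraph {n : ℕ} (p : Fin n → Plane) (f : Constants n) (x : Motions n) :
    MarkedGraph n where
  graph :=
    { Adj := fun i j => i ≠ j ∧ edgeForm p i j x = f.edge i j
      symm := ⟨fun i j h => ⟨h.1.symm, by rw [edgeForm_comm, f.edge_symm, h.2]⟩⟩
      loopless := ⟨fun _ h => h.1 rfl⟩ }
  marks := {j | x.2 j = f.mark j}

/-- `F` is a (non-empty) face of `P`: the set of the points of `P` where some linear functional
attains its maximum over `P`. The zero functional gives `P` itself. -/
def IsFace {n : ℕ} (P F : Set (Motions n)) : Prop :=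
  F.Nonempty ∧ IsExposed ℝ P F

/-- `f` is valid for `p` if the tight marked graph of every face of the polyhedron of expansions,
which is the tight marked graph of any relative interior point of the face, is non-crossing. -/
def IsValid {n : ℕ} (p : Fin n → Plane) (f : Constants n) : Prop :=
  ∀ F : Set (Motions n), IsFace (expansionPolyhedron p f) F →
    ∀ x ∈ intrinsicInterior ℝ F, (tightMarkedGraph p f x).IsNonCrossing p

/-! ### Explicit constants -/

/-- The choice `f_{ij} = det(a, p_i, p_j) det(b, p_i, p_j)`, `f_{0j} = 0`. -/
noncomputable def detConstants {n : ℕ} (p : Fin n → Plane) (a b : Plane) : Constants n where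
  edge i j := det3 a (p i) (p j) * det3 b (p i) (p j)
  edge_symm i j := by simp only [det3, Matrix.det_fin_three]; simp; ring
  mark _ := 0

/-- The choice `f_{ij} = det(O, p_i, p_j)²`, `f_{0j} = 0`, where `O` is the origin. -/
noncomputable def originDetConstants {n : ℕ} (p : Fin n → Plane) : Constants n where
  edge i j := det3 0 (p i) (p j) ^ 2
  edge_symm i j := by simp only [det3, Matrix.det_fin_three]; simp; ring
  mark _ := 0

/-- The coefficient `w_{ij} = 1 / (det(q_i, q_j, q_k) det(q_i, q_j, q_l))` of four points, where
`k` and `l` are the two indices other than `i` and `j`. -/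
noncomputable def stressWeight (q : Fin 4 → Plane) (i j : Fin 4) : ℝ :=
  1 / ∏ k ∈ Finset.univ \ {i, j}, det3 (q i) (q j) (q k)

end MarkedNonCrossing

namespace MarkedNonCrossing

/-! Four points with an affine dependence `λ` (`∑ λᵢ = 0`, `∑ λᵢ pᵢ = 0`) carry the self-stress `λᵢ
λⱼ`, which kills the velocity part of the edge forms and leaves a combination of the `tᵢ`
(`stress_pairForm`). Its value on the constants does not depend on `a`, `b`: with `Pᵢ = (pᵢ, 1)`,
the matrix `M = ∑ λᵢ Pᵢ Pᵢᵀ` has zero last row and column, so only the corner entry of its cofactor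
matrix survives. For `λ = (-1, α, β, γ)` that entry is `αβγ det²` (`stress_det3_mul_det3`).

If two crossing edges are tight, or three tight edges surround a marked point, every other edge of
the quadruple has stress of one sign. The edge inequalities and the triangle inequality then give
the combination of the `tᵢ` a sign that contradicts `αβγ det² ≠ 0`. This excludes both
configurations at every point of the polyhedron. -/

theorem det3_eq (a b c : Plane) :
    det3 a b c = a 0 * b 1 - a 0 * c 1 - a 1 * b 0 + a 1 * c 0 + b 0 * c 1 - b 1 * c 0 := by
  simp [det3, Matrix.det_fin_three]

theorem collinear_of_det3_eq_zero {a b c : Plane} (h : det3 a b c = 0) :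
    Collinear ℝ ({a, b, c} : Set Plane) := by
  rw [det3_eq] at h
  by_cases hab : b = a
  · subst hab
    simpa using collinear_pair ℝ b c
  rw [collinear_iff_of_mem (p₀ := a) (by simp)]
  have key : ∃ r : ℝ, c = r • (b - a) + a := by
    by_cases h0 : b 0 - a 0 = 0
    · have h1 : b 1 - a 1 ≠ 0 := by
        intro h1
        apply hab
        ext i
        fin_cases i
        · simpa using sub_eq_zero.1 h0
        · simpa using sub_eq_zero.1 h1
      refine ⟨(c 1 - a 1) / (b 1 - a 1), ?_⟩
      ext i
      fin_cases i
      · simp only [Fin.zero_eta, PiLp.add_apply, PiLp.smul_apply, PiLp.sub_apply, smul_eq_mul]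
        field_simp
        linear_combination -h
      · simp only [Fin.mk_one, PiLp.add_apply, PiLp.smul_apply, PiLp.sub_apply, smul_eq_mul]
        field_simp
        ring
    · refine ⟨(c 0 - a 0) / (b 0 - a 0), ?_⟩
      ext i
      fin_cases i
      · simp only [Fin.zero_eta, PiLp.add_apply, PiLp.smul_apply, PiLp.sub_apply, smul_eq_mul]
        field_simp
        ring
      · simp only [Fin.mk_one, PiLp.add_apply, PiLp.smul_apply, PiLp.sub_apply, smul_eq_mul]
        field_simp
        linear_combination h
  obtain ⟨r, hr⟩ := key
  refine ⟨b - a, ?_⟩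
  rintro q (rfl | rfl | rfl)
  · exact ⟨0, by simp⟩
  · exact ⟨1, by simp⟩
  · exact ⟨r, by simpa using hr⟩

theorem GeneralPosition.det3_ne_zero {n : ℕ} {p : Fin n → Plane} (hp : GeneralPosition p)
    {i j k : Fin n} (hij : i ≠ j) (hik : i ≠ k) (hjk : j ≠ k) : det3 (p i) (p j) (p k) ≠ 0 :=
  fun h => hp.2 i j k hij hik hjk (collinear_of_det3_eq_zero h)

theorem det3_eq_zero_of_eq_combo {a b c : Plane} {s : ℝ} (h : a = (1 - s) • b + s • c) :
    det3 a b c = 0 := by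
  subst h
  rw [det3_eq]
  simp only [PiLp.add_apply, PiLp.smul_apply, smul_eq_mul]
  ring

/-! ### Self-stresses of four points -/

/-- The forms of the constrained expansions for points `a, b` with velocities `v, w` and
scalars `s, t`. -/
noncomputable def pairForm (a b v w : Plane) (s t : ℝ) : ℝ :=
  inner ℝ (a - b) (v - w) - ‖a - b‖ * (s + t)

/-- The stress with coefficients `λᵢ λⱼ` of an affine dependence `λ = (-1, α, β, γ)`, applied to
the constants given by a product of determinants. -/
theorem stress_det3_mul_det3 {p₁ p₂ p₃ p₄ : Plane} {α β γ : ℝ} (hs : α + β + γ = 1)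
    (hp : p₁ = α • p₂ + β • p₃ + γ • p₄) (a b : Plane) :
    -α * (det3 a p₁ p₂ * det3 b p₁ p₂) - β * (det3 a p₁ p₃ * det3 b p₁ p₃)
      - γ * (det3 a p₁ p₄ * det3 b p₁ p₄) + α * β * (det3 a p₂ p₃ * det3 b p₂ p₃)
      + α * γ * (det3 a p₂ p₄ * det3 b p₂ p₄) + β * γ * (det3 a p₃ p₄ * det3 b p₃ p₄)
      = α * β * γ * det3 p₂ p₃ p₄ ^ 2 := by
  obtain rfl : γ = 1 - α - β := by linarith
  subst hp
  simp only [det3_eq, PiLp.add_apply, PiLp.smul_apply, smul_eq_mul]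
  ring

/-- The velocities cancel because the sum of `λᵢ λⱼ ⟨pᵢ - pⱼ, vᵢ - vⱼ⟩` over all pairs is `(∑ λᵢ)(∑
λᵢ ⟨pᵢ, vᵢ⟩) - ⟨∑ λᵢ pᵢ, ∑ λᵢ vᵢ⟩`. -/
theorem stress_pairForm {p₁ p₂ p₃ p₄ : Plane} {α β γ : ℝ} (hs : α + β + γ = 1)
    (hp : p₁ = α • p₂ + β • p₃ + γ • p₄) (v₁ v₂ v₃ v₄ : Plane) (t₁ t₂ t₃ t₄ : ℝ) :
    -α * pairForm p₁ p₂ v₁ v₂ t₁ t₂ - β * pairForm p₁ p₃ v₁ v₃ t₁ t₃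
      - γ * pairForm p₁ p₄ v₁ v₄ t₁ t₄ + α * β * pairForm p₂ p₃ v₂ v₃ t₂ t₃
      + α * γ * pairForm p₂ p₄ v₂ v₄ t₂ t₄ + β * γ * pairForm p₃ p₄ v₃ v₄ t₃ t₄
      = t₁ * (α * ‖p₁ - p₂‖ + β * ‖p₁ - p₃‖ + γ * ‖p₁ - p₄‖)
        + t₂ * (α * (‖p₁ - p₂‖ - β * ‖p₂ - p₃‖ - γ * ‖p₂ - p₄‖))
        + t₃ * (β * (‖p₁ - p₃‖ - α * ‖p₂ - p₃‖ - γ * ‖p₃ - p₄‖))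
        + t₄ * (γ * (‖p₁ - p₄‖ - α * ‖p₂ - p₄‖ - β * ‖p₃ - p₄‖)) := by
  have h : -α * inner ℝ (p₁ - p₂) (v₁ - v₂) - β * inner ℝ (p₁ - p₃) (v₁ - v₃)
      - γ * inner ℝ (p₁ - p₄) (v₁ - v₄) + α * β * inner ℝ (p₂ - p₃) (v₂ - v₃)
      + α * γ * inner ℝ (p₂ - p₄) (v₂ - v₄) + β * γ * inner ℝ (p₃ - p₄) (v₃ - v₄) = 0 := by
    obtain rfl : γ = 1 - α - β := by linarith
    subst hp
    simp only [inner_sub_left, inner_sub_right, inner_add_left, inner_smul_left,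
      RCLike.conj_to_real]
    ring
  unfold pairForm
  linear_combination h

theorem norm_le_of_eq_smul_add_smul {x y z : Plane} {r s : ℝ} (h : x = r • y + s • z) :
    ‖x‖ ≤ |r| * ‖y‖ + |s| * ‖z‖ := by
  subst h
  simpa [norm_smul] using norm_add_le (r • y) (s • z)

/-! ### Forbidden tight configurations -/

variable {n : ℕ} {p : Fin n → Plane} {a b : Plane} {x : Motions n}

theorem edgeForm_eq_pairForm (i j : Fin n) :
    edgeForm p i j x = pairForm (p i) (p j) (x.1 i) (x.1 j) (x.2 i) (x.2 j) := rfl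

/-- Tight edges at a marked point in the interior of a triangle are impossible. -/
theorem not_tight_of_mem_interior_triangle (hx : x ∈ expansionPolyhedron p (detConstants p a b))
    {i j k l : Fin n} (hjk : j ≠ k) (hjl : j ≠ l) (hkl : k ≠ l)
    (hD : det3 (p j) (p k) (p l) ≠ 0) {α β γ : ℝ} (hα : 0 < α) (hβ : 0 < β) (hγ : 0 < γ)
    (hs : α + β + γ = 1) (hp : p i = α • p j + β • p k + γ • p l) (hi : x.2 i = 0)
    (hij : edgeForm p i j x = (detConstants p a b).edge i j)
    (hik : edgeForm p i k x = (detConstants p a b).edge i k)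
    (hil : edgeForm p i l x = (detConstants p a b).edge i l) : False := by
  have h1 := stress_det3_mul_det3 hs hp a b
  have h2 := stress_pairForm hs hp (x.1 i) (x.1 j) (x.1 k) (x.1 l) (x.2 i) (x.2 j) (x.2 k) (x.2 l)
  simp only [← edgeForm_eq_pairForm] at h2
  have e1 := hx.2.1 j k hjk
  have e2 := hx.2.1 j l hjl
  have e3 := hx.2.1 k l hkl
  have tj : 0 ≤ x.2 j := hx.2.2 j
  have tk : 0 ≤ x.2 k := hx.2.2 k
  have tl : 0 ≤ x.2 l := hx.2.2 l
  simp only [detConstants] at hij hik hil e1 e2 e3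
  -- Eliminating `α` lets `module` use that the coefficients sum to one; the `generalize` below
  -- restores it as an atom.
  obtain rfl : α = 1 - β - γ := by linarith
  -- These bounds make the coefficients of `t_j`, `t_k`, `t_l` nonpositive; the nonnegative
  -- coefficient of `t_i` is harmless since `t_i = 0`.
  have n1 : ‖p i - p j‖ ≤ β * ‖p j - p k‖ + γ * ‖p j - p l‖ := by
    have := norm_le_of_eq_smul_add_smul (x := p i - p j) (y := p j - p k) (z := p j - p l)
      (r := -β) (s := -γ) (by rw [hp]; module)
    simpa [abs_of_pos hβ, abs_of_pos hγ] using this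
  have n2 : ‖p i - p k‖ ≤ (1 - β - γ) * ‖p j - p k‖ + γ * ‖p k - p l‖ := by
    have := norm_le_of_eq_smul_add_smul (x := p i - p k) (y := p j - p k) (z := p k - p l)
      (r := 1 - β - γ) (s := -γ) (by rw [hp]; module)
    simpa [abs_of_pos hα, abs_of_pos hγ] using this
  have n3 : ‖p i - p l‖ ≤ (1 - β - γ) * ‖p j - p l‖ + β * ‖p k - p l‖ := by
    have := norm_le_of_eq_smul_add_smul (x := p i - p l) (y := p j - p l) (z := p k - p l)
      (r := 1 - β - γ) (s := β) (by rw [hp]; module)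
    simpa [abs_of_pos hα, abs_of_pos hβ] using this
  generalize 1 - β - γ = α at *
  have m1 := mul_nonneg tj (mul_nonneg hα.le (sub_nonneg.2 n1))
  have m2 := mul_nonneg tk (mul_nonneg hβ.le (sub_nonneg.2 n2))
  have m3 := mul_nonneg tl (mul_nonneg hγ.le (sub_nonneg.2 n3))
  have f1 := mul_nonneg (mul_pos hα hβ).le (sub_nonneg.2 e1)
  have f2 := mul_nonneg (mul_pos hα hγ).le (sub_nonneg.2 e2)
  have f3 := mul_nonneg (mul_pos hβ hγ).le (sub_nonneg.2 e3)
  have hpos : 0 < α * β * γ * det3 (p j) (p k) (p l) ^ 2 := by positivity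
  rw [hij, hik, hil, hi] at h2
  linarith

/-- The diagonals of a convex quadrilateral are not both tight. -/
theorem not_tight_diagonals (hx : x ∈ expansionPolyhedron p (detConstants p a b))
    {i j k l : Fin n} (hik : i ≠ k) (hil : i ≠ l) (hjk : j ≠ k) (hjl : j ≠ l)
    (hD : det3 (p j) (p k) (p l) ≠ 0) {α β γ : ℝ} (hα : 0 < α) (hβ : 0 < β) (hγ : 0 < γ)
    (hs : -α + β + γ = 1) (hp : p i = (-α) • p j + β • p k + γ • p l)
    (hij : edgeForm p i j x = (detConstants p a b).edge i j)
    (hkl : edgeForm p k l x = (detConstants p a b).edge k l) : False := by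
  have h1 := stress_det3_mul_det3 hs hp a b
  have h2 := stress_pairForm hs hp (x.1 i) (x.1 j) (x.1 k) (x.1 l) (x.2 i) (x.2 j) (x.2 k) (x.2 l)
  simp only [← edgeForm_eq_pairForm] at h2
  have e1 := hx.2.1 j k hjk
  have e2 := hx.2.1 j l hjl
  have e3 := hx.2.1 i k hik
  have e4 := hx.2.1 i l hil
  have ti : 0 ≤ x.2 i := hx.2.2 i
  have tj : 0 ≤ x.2 j := hx.2.2 j
  have tk : 0 ≤ x.2 k := hx.2.2 k
  have tl : 0 ≤ x.2 l := hx.2.2 l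
  simp only [detConstants] at hij hkl e1 e2 e3 e4
  obtain rfl : α = β + γ - 1 := by linarith
  -- All four `t` coefficients are nonnegative here, while the sides have negative stress and the
  -- constants give `-αβγ det² < 0`.
  have n0 : (β + γ - 1) * ‖p i - p j‖ ≤ β * ‖p i - p k‖ + γ * ‖p i - p l‖ := by
    have := norm_le_of_eq_smul_add_smul (x := (β + γ - 1) • (p i - p j)) (y := p i - p k)
      (z := p i - p l) (r := β) (s := γ) (by rw [hp]; module)
    simpa [norm_smul, abs_of_pos hβ, abs_of_pos hγ, abs_of_pos hα] using this
  have n1 : ‖p i - p j‖ ≤ β * ‖p j - p k‖ + γ * ‖p j - p l‖ := by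
    have := norm_le_of_eq_smul_add_smul (x := p i - p j) (y := p j - p k) (z := p j - p l)
      (r := -β) (s := -γ) (by rw [hp]; module)
    simpa [abs_of_pos hβ, abs_of_pos hγ] using this
  have n2 : γ * ‖p k - p l‖ ≤ (β + γ - 1) * ‖p j - p k‖ + ‖p i - p k‖ := by
    have := norm_le_of_eq_smul_add_smul (x := γ • (p k - p l)) (y := p j - p k) (z := p i - p k)
      (r := -(β + γ - 1)) (s := -1) (by rw [hp]; module)
    simpa only [norm_smul, Real.norm_eq_abs, abs_neg, abs_one, one_mul, abs_of_pos hα,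
      abs_of_pos hγ] using this
  have n3 : β * ‖p k - p l‖ ≤ (β + γ - 1) * ‖p j - p l‖ + ‖p i - p l‖ := by
    have := norm_le_of_eq_smul_add_smul (x := β • (p k - p l)) (y := p j - p l) (z := p i - p l)
      (r := β + γ - 1) (s := 1) (by rw [hp]; module)
    simpa only [norm_smul, Real.norm_eq_abs, abs_neg, abs_one, one_mul, abs_of_pos hα,
      abs_of_pos hβ] using this
  generalize β + γ - 1 = α at *
  have m0 := mul_nonneg ti (sub_nonneg.2 n0)
  have m1 := mul_nonneg tj (mul_nonneg hα.le (sub_nonneg.2 n1))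
  have m2 := mul_nonneg tk (mul_nonneg hβ.le (sub_nonneg.2 n2))
  have m3 := mul_nonneg tl (mul_nonneg hγ.le (sub_nonneg.2 n3))
  have f1 := mul_nonneg (mul_pos hα hβ).le (sub_nonneg.2 e1)
  have f2 := mul_nonneg (mul_pos hα hγ).le (sub_nonneg.2 e2)
  have f3 := mul_nonneg hβ.le (sub_nonneg.2 e3)
  have f4 := mul_nonneg hγ.le (sub_nonneg.2 e4)
  have hpos : 0 < α * β * γ * det3 (p j) (p k) (p l) ^ 2 := by positivity
  rw [hij, hkl] at h2
  linarith

/-! ### Tight edges do not cross -/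

theorem segment_inter_segment_subset_of_det3_ne_zero {a b c : Plane} (h : det3 a b c ≠ 0) :
    segment ℝ a b ∩ segment ℝ a c ⊆ {a} := by
  rintro y ⟨hb, hc⟩
  rw [segment_eq_image] at hb hc
  obtain ⟨s, -, rfl⟩ := hb
  obtain ⟨r, -, hr⟩ := hc
  have h0 := congrArg (fun z : Plane => z 0) hr
  have h1 := congrArg (fun z : Plane => z 1) hr
  simp only [PiLp.add_apply, PiLp.smul_apply, smul_eq_mul] at h0 h1
  have hs : s * det3 a b c = 0 := by
    rw [det3_eq]
    linear_combination (c 0 - a 0) * h1 - (c 1 - a 1) * h0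
  obtain rfl : s = 0 := (mul_eq_zero.1 hs).resolve_right h
  simp

theorem segment_inter_segment_subset_of_shared (hp : GeneralPosition p) {i j l : Fin n}
    (hij : i ≠ j) (hil : i ≠ l) (hjl : j ≠ l) :
    segment ℝ (p i) (p j) ∩ segment ℝ (p i) (p l) ⊆ ({p i, p j} ∩ {p i, p l} : Set Plane) := by
  intro y hy
  obtain rfl := segment_inter_segment_subset_of_det3_ne_zero (hp.det3_ne_zero hij hil hjl) hy
  simp

theorem tight_isNonCrossingGraph (hp : GeneralPosition p)
    (hx : x ∈ expansionPolyhedron p (detConstants p a b)) :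
    IsNonCrossingGraph p (tightMarkedGraph p (detConstants p a b) x).graph := by
  rintro i j k l ⟨hij, eij⟩ ⟨hkl, ekl⟩ hne
  by_cases hik : i = k
  · subst hik
    exact segment_inter_segment_subset_of_shared hp hij hkl (by rintro rfl; exact hne rfl)
  by_cases hil : i = l
  · subst hil
    rw [segment_symm ℝ (p k), Set.pair_comm (p k)]
    exact segment_inter_segment_subset_of_shared hp hij hkl.symm
      (by rintro rfl; exact hne Sym2.eq_swap)
  by_cases hjk : j = k
  · subst hjk
    rw [segment_symm ℝ (p i), Set.pair_comm (p i)]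
    exact segment_inter_segment_subset_of_shared hp hij.symm hkl hil
  by_cases hjl : j = l
  · subst hjl
    rw [segment_symm ℝ (p i), Set.pair_comm (p i), segment_symm ℝ (p k), Set.pair_comm (p k)]
    exact segment_inter_segment_subset_of_shared hp hij.symm hkl.symm hik
  rintro y ⟨hy, hy'⟩
  exfalso
  rw [segment_eq_image] at hy hy'
  obtain ⟨s, ⟨hs0, hs1⟩, rfl⟩ := hy
  obtain ⟨r, ⟨hr0, hr1⟩, hr⟩ := hy'
  dsimp only at hr
  -- An end-point on the other segment would give three collinear points.
  have hs0' : s ≠ 0 := by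
    rintro rfl
    exact hp.det3_ne_zero hik hil hkl (det3_eq_zero_of_eq_combo (s := r) (by rw [hr]; simp))
  have hs1' : s ≠ 1 := by
    rintro rfl
    exact hp.det3_ne_zero hjk hjl hkl (det3_eq_zero_of_eq_combo (s := r) (by rw [hr]; simp))
  have hr0' : r ≠ 0 := by
    rintro rfl
    exact hp.det3_ne_zero (Ne.symm hik) (Ne.symm hjk) hij
      (det3_eq_zero_of_eq_combo (s := s) (by rw [← hr]; simp))
  have hr1' : r ≠ 1 := by
    rintro rfl
    exact hp.det3_ne_zero (Ne.symm hil) (Ne.symm hjl) hij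
      (det3_eq_zero_of_eq_combo (s := s) (by rw [← hr]; simp))
  have s0 : 0 < s := lt_of_le_of_ne hs0 hs0'.symm
  have s1 : 0 < 1 - s := sub_pos.2 (lt_of_le_of_ne hs1 hs1')
  have r0 : 0 < r := lt_of_le_of_ne hr0 hr0'.symm
  have r1 : 0 < 1 - r := sub_pos.2 (lt_of_le_of_ne hr1 hr1')
  refine not_tight_diagonals hx hik hil hjk hjl (hp.det3_ne_zero hjk hjl hkl)
    (div_pos s0 s1) (div_pos r1 s1) (div_pos r0 s1) (by field_simp; ring) ?_ eij ekl
  -- Solving the two expressions of the crossing point for `p i` gives the affine dependence of a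
  -- convex quadrilateral.
  have h2 : (1 - s) • p i = (-s) • p j + (1 - r) • p k + r • p l := by
    rw [add_assoc, hr]; module
  have h3 := congrArg (fun z => (1 - s)⁻¹ • z) h2
  simp only [smul_smul, smul_add, inv_mul_cancel₀ s1.ne', one_smul] at h3
  rw [h3]
  simp only [div_eq_inv_mul, mul_neg, neg_smul]

/-! ### Marked vertices are pointed -/

/-- A point in no open half-plane supported at `c` with all of the finite set `T` lies in the
convex hull of `T`. -/
theorem mem_convexHull_of_forall_not_inner_pos {T : Set Plane} (hT : T.Finite) {c : Plane}
    (h : ∀ u : Plane, ∃ q ∈ T, ¬ 0 < inner ℝ u (q - c)) : c ∈ convexHull ℝ T := by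
  by_contra hc
  obtain ⟨f, s, h1, h2⟩ := geometric_hahn_banach_point_closed (convex_convexHull ℝ T)
    (hT.isClosed_convexHull (𝕜 := ℝ)) hc
  obtain ⟨q, hq, hq'⟩ := h ((InnerProductSpace.toDual ℝ Plane).symm f)
  apply hq'
  rw [InnerProductSpace.toDual_symm_apply, map_sub]
  linarith [h2 q (subset_convexHull ℝ T hq)]

/-- A vertex that is not pointed lies in the convex hull of its neighbours. By Carathéodory it is a
positive combination of at most three of them, and general position forces exactly three. -/
theorem tight_isPointedVertex (hp : GeneralPosition p)
    (hx : x ∈ expansionPolyhedron p (detConstants p a b)) {i : Fin n} (hi : x.2 i = 0) :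
    IsPointedVertex p (tightMarkedGraph p (detConstants p a b) x).graph i := by
  set G := (tightMarkedGraph p (detConstants p a b) x).graph
  by_contra hnp
  have hmem : p i ∈ convexHull ℝ (p '' {j | G.Adj i j}) := by
    refine mem_convexHull_of_forall_not_inner_pos (Set.toFinite _) fun u => ?_
    by_contra! hu
    exact hnp ⟨u, fun j hj => hu _ ⟨j, hj, rfl⟩⟩
  obtain ⟨ι, _, z, w, hz, hzi, hw, hw1, hwz⟩ := eq_pos_convex_span_of_mem_convexHull hmem
  choose g hg hgz using fun m => hz (Set.mem_range_self m)
  obtain rfl : p ∘ g = z := funext hgz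
  have hginj : Function.Injective g := fun m m' h => hzi.injective (by simp [h])
  -- Affinely independent points of the plane number at most `2 + 1`.
  have hcard : Fintype.card ι ≤ 3 := by
    have := hzi.card_le_finrank_succ
    have h2 := (vectorSpan ℝ (Set.range (p ∘ g))).finrank_le
    rw [finrank_euclideanSpace_fin] at h2
    omega
  have e := Fintype.equivFin ι
  rw [← e.symm.sum_comp] at hw1 hwz
  replace hw : ∀ m, 0 < w (e.symm m) := fun m => hw _
  replace hg : ∀ m, i ≠ g (e.symm m) ∧ edgeForm p i (g (e.symm m)) x =
    (detConstants p a b).edge i (g (e.symm m)) := fun m => hg _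
  have hne : ∀ m m', m ≠ m' → g (e.symm m) ≠ g (e.symm m') := fun m m' h h' =>
    h (e.symm.injective (hginj h'))
  simp only [Function.comp_apply] at hwz
  generalize Fintype.card ι = N at *
  interval_cases N
  · simp at hw1
  · simp only [Fin.sum_univ_one] at hw1 hwz
    rw [hw1, one_smul] at hwz
    exact (hg 0).1 (hp.1 hwz.symm)
  · simp only [Fin.sum_univ_two] at hw1 hwz
    refine hp.det3_ne_zero (hg 0).1 (hg 1).1 (hne 0 1 (by decide))
      (det3_eq_zero_of_eq_combo (s := w (e.symm 1)) ?_)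
    rw [← hwz, ← hw1, add_sub_cancel_right]
  · simp only [Fin.sum_univ_three] at hw1 hwz
    have h01 := hne 0 1 (by decide)
    have h02 := hne 0 2 (by decide)
    have h12 := hne 1 2 (by decide)
    exact not_tight_of_mem_interior_triangle hx h01 h02 h12 (hp.det3_ne_zero h01 h02 h12)
      (hw 0) (hw 1) (hw 2) hw1 hwz.symm hi (hg 0).2 (hg 1).2 (hg 2).2

/-! ### Validity and the four-point identity -/

theorem isValid_detConstants (hp : GeneralPosition p) (a b : Plane) :
    IsValid p (detConstants p a b) := by
  intro F hF x hx
  -- Only membership in the polyhedron matters, not the position of `x` within the face.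
  have hxP := hF.2.subset (intrinsicInterior_subset hx)
  exact ⟨tight_isNonCrossingGraph hp hxP, fun i hi => tight_isPointedVertex hp hxP hi⟩

theorem originDetConstants_eq (p : Fin n → Plane) :
    originDetConstants p = detConstants p 0 0 := by
  simp [originDetConstants, detConstants, sq]

/-- By Cramer's rule `λᵢ` is, up to alternating sign, the determinant of the other three points.
Hence the weights are `λᵢ λⱼ` divided by the product of all four determinants, up to a common sign.
-/
theorem sum_stressWeight_mul_det3 {q : Fin 4 → Plane} (hq : GeneralPosition q) (a b : Plane) :
    ∑ i : Fin 4, ∑ j ∈ Finset.Ioi i,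
      stressWeight q i j * (det3 a (q i) (q j) * det3 b (q i) (q j)) = 1 := by
  have hA := hq.det3_ne_zero (i := 0) (j := 1) (k := 2) (by decide) (by decide) (by decide)
  have hB := hq.det3_ne_zero (i := 0) (j := 1) (k := 3) (by decide) (by decide) (by decide)
  have hC := hq.det3_ne_zero (i := 0) (j := 2) (k := 3) (by decide) (by decide) (by decide)
  have hD := hq.det3_ne_zero (i := 1) (j := 2) (k := 3) (by decide) (by decide) (by decide)
  have i0 : Finset.Ioi (0 : Fin 4) = {1, 2, 3} := by decide
  have i1 : Finset.Ioi (1 : Fin 4) = {2, 3} := by decide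
  have i2 : Finset.Ioi (2 : Fin 4) = {3} := by decide
  have i3 : Finset.Ioi (3 : Fin 4) = ∅ := by decide
  have w01 : (Finset.univ : Finset (Fin 4)) \ {0, 1} = {2, 3} := by decide
  have w02 : (Finset.univ : Finset (Fin 4)) \ {0, 2} = {1, 3} := by decide
  have w03 : (Finset.univ : Finset (Fin 4)) \ {0, 3} = {1, 2} := by decide
  have w12 : (Finset.univ : Finset (Fin 4)) \ {1, 2} = {0, 3} := by decide
  have w13 : (Finset.univ : Finset (Fin 4)) \ {1, 3} = {0, 2} := by decide
  have w23 : (Finset.univ : Finset (Fin 4)) \ {2, 3} = {0, 1} := by decide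
  have swap : ∀ x y z : Plane, det3 x z y = -det3 x y z := fun x y z => by
    simp only [det3_eq]; ring
  have rot : ∀ x y z : Plane, det3 y z x = det3 x y z := fun x y z => by
    simp only [det3_eq]; ring
  -- This is the identity multiplied by the product of the four determinants.
  have key : ∀ q₀ q₁ q₂ q₃ : Plane,
      det3 q₀ q₂ q₃ * det3 q₁ q₂ q₃ * (det3 a q₀ q₁ * det3 b q₀ q₁)
      - det3 q₀ q₁ q₃ * det3 q₁ q₂ q₃ * (det3 a q₀ q₂ * det3 b q₀ q₂)
      + det3 q₀ q₁ q₂ * det3 q₁ q₂ q₃ * (det3 a q₀ q₃ * det3 b q₀ q₃)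
      + det3 q₀ q₁ q₃ * det3 q₀ q₂ q₃ * (det3 a q₁ q₂ * det3 b q₁ q₂)
      - det3 q₀ q₁ q₂ * det3 q₀ q₂ q₃ * (det3 a q₁ q₃ * det3 b q₁ q₃)
      + det3 q₀ q₁ q₂ * det3 q₀ q₁ q₃ * (det3 a q₂ q₃ * det3 b q₂ q₃)
      = det3 q₀ q₁ q₂ * det3 q₀ q₁ q₃ * det3 q₀ q₂ q₃ * det3 q₁ q₂ q₃ := by
    intro q₀ q₁ q₂ q₃
    simp only [det3_eq]
    ring
  have hk := key (q 0) (q 1) (q 2) (q 3)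
  have s02 : det3 (q 0) (q 2) (q 1) = -det3 (q 0) (q 1) (q 2) := swap _ _ _
  have s03 : det3 (q 0) (q 3) (q 1) = -det3 (q 0) (q 1) (q 3) := swap _ _ _
  have s032 : det3 (q 0) (q 3) (q 2) = -det3 (q 0) (q 2) (q 3) := swap _ _ _
  have s132 : det3 (q 1) (q 3) (q 2) = -det3 (q 1) (q 2) (q 3) := swap _ _ _
  have r120 : det3 (q 1) (q 2) (q 0) = det3 (q 0) (q 1) (q 2) := rot _ _ _
  have r130 : det3 (q 1) (q 3) (q 0) = det3 (q 0) (q 1) (q 3) := rot _ _ _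
  have r230 : det3 (q 2) (q 3) (q 0) = det3 (q 0) (q 2) (q 3) := rot _ _ _
  have r231 : det3 (q 2) (q 3) (q 1) = det3 (q 1) (q 2) (q 3) := rot _ _ _
  simp only [Fin.sum_univ_four, i0, i1, i2, i3, stressWeight]
  rw [Finset.sum_insert (by decide), Finset.sum_pair (by decide), Finset.sum_pair (by decide),
    Finset.sum_singleton, Finset.sum_empty, w01, w02, w03, w12, w13, w23,
    Finset.prod_pair (by decide), Finset.prod_pair (by decide), Finset.prod_pair (by decide),
    Finset.prod_pair (by decide), Finset.prod_pair (by decide), Finset.prod_pair (by decide),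
    s02, s03, s032, s132, r120, r130, r230, r231]
  field_simp
  linear_combination hk

end MarkedNonCrossing

theorem mainTheorem6 :
    (∀ (n : ℕ) (p : Fin n → MarkedNonCrossing.Plane), MarkedNonCrossing.GeneralPosition p →
      (∀ a b : MarkedNonCrossing.Plane,
        MarkedNonCrossing.IsValid p (MarkedNonCrossing.detConstants p a b)) ∧
      MarkedNonCrossing.IsValid p (MarkedNonCrossing.originDetConstants p)) ∧
    (∀ q : Fin 4 → MarkedNonCrossing.Plane, MarkedNonCrossing.GeneralPosition q →
      ∀ a b : MarkedNonCrossing.Plane,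
        ∑ i : Fin 4, ∑ j ∈ Finset.Ioi i, MarkedNonCrossing.stressWeight q i j *
          (MarkedNonCrossing.det3 a (q i) (q j) * MarkedNonCrossing.det3 b (q i) (q j)) = 1) := by
  refine ⟨fun n p hp => ⟨MarkedNonCrossing.isValid_detConstants hp, ?_⟩,
    fun q hq a b => MarkedNonCrossing.sum_stressWeight_mul_det3 hq a b⟩
  rw [MarkedNonCrossing.originDetConstants_eq]
  exact MarkedNonCrossing.isValid_detConstants hp 0 0
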